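/- Let $(C,o)\subset(\mathbb C^N,0)$ be a reduced complex curve singularity with local algebra $\mathcal O$, branches $(C_1,o),\dots,(C_r,o)$ and normalization maps $n_i:(\mathbb C,0)\to(C_i,o)$; write $n_i^*:\mathcal O\to\mathcal O_{C_i,o}\hookrightarrow\mathbb C\{t_i\}$ and $\mathfrak v_i(g)=\operatorname{ord}_{t_i}(n_i^*g)\in\mathbb Z_{\ge0}\cup\{\infty\}$. For $\ell\in\mathbb Z_{\ge0}^r$ let $\mathfrak h(\ell)=\dim_{\mathbb C}\mathcal O/\{g\in\mathcal O:\mathfrak v_i(g)\ge\ell_i\text{ for all }i\}$ and let $w(\ell)=2\,\mathfrak h(\ell)-\sum_{i=1}^r\ell_i$ be the weight function. Let $\mathcal S=\{(\mathfrak v_1(g),\dots,\mathfrak v_r(g)) : g\in\mathcal O\text{ not a zero divisor}\}$ be the semigroup of values, let $\mathbf m=(m_1,\dots,m_r)$ with $m_i$ the multiplicity of the branch $(C_i,o)$, let $m(C,o)$ be the multiplicity of $(C,o)$, and let $\mathbf c=(c_1,\dots,c_r)$ be the conductor, i.e. the lattice point for which the conductor ideal $(\mathcal O:\overline{\mathcal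 O})$ of $\mathcal O$ in its normalization $\overline{\mathcal O}=\prod_{i}\mathbb C\{t_i\}$ equals $(t_1^{c_1},\dots,t_r^{c_r})\overline{\mathcal O}$. Let $e_i$ be the standard basis vectors and order $\mathbb Z^r$ coordinatewise. A point $p\in\mathbb Z_{\ge0}^r$ is a generalized local minimum point of $w$ if $w(p)<w(p-e_i)$ for every $i$ with $p\ge e_i$; it is a local minimum point if moreover $w(p)<w(p+e_i)$ for every $i$. (a) If $p\in\mathbb Z_{\ge0}^r$ is a generalized local minimum point of $w$ with $w(p)=0$, then $w(p-\ell)=w(\ell)$ for every lattice point $\ell$ with $\mathbf 0\le\ell\le p$. If moreover $p\ge\mathbf m$, then $p$ is a local minimum point of $w$ and $p\in\mathcal S$. (b) If $m(C,o)\ge3$ and $p$ is a local minimum point of $w$ with $w(p)=0$, then $p\in\{\mathbf 0,\mathbf c\}$. -/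

import Mathlib

open Filter Topology

noncomputable section

namespace CurveSing

/-! ### Germs of holomorphic functions at the origin -/

/-- Germs of `ℂ`-valued functions form a `ℂ`-algebra (pointwise operations). -/
instance germAlgebra {X : Type} (l : Filter X) : Algebra ℂ (Germ l ℂ) :=
  Algebra.ofModule
    (fun c f g => by
      induction f using Germ.inductionOn with
      | _ f => induction g using Germ.inductionOn with
        | _ g => exact congrArg _ (smul_mul_assoc c f g))
    (fun c f g => by
      induction f using Germ.inductionOn with
      | _ f => induction g using Germ.inductionOn with
        | _ g => exact congrArg _ (mul_smul_comm c f g))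

theorem germ_algebraMap {X : Type} (l : Filter X) (c : ℂ) :
    algebraMap ℂ (Germ l ℂ) c = ((fun _ => c : X → ℂ) : Germ l ℂ) := by
  rw [Algebra.algebraMap_eq_smul_one]
  change (((c • (1 : X → ℂ)) : X → ℂ) : Germ l ℂ) = _
  congr 1
  funext x
  simp

/-- The ring of germs at `0` of holomorphic functions on `E`. For `E = Fin N → ℂ` this is the
ring of convergent power series `ℂ{x₁, …, x_N}`, for `E = ℂ` it is `ℂ{t}`. -/
def HolGerm (E : Type) [NormedAddCommGroup E] [NormedSpace ℂ E] :
    Subalgebra ℂ (Germ (𝓝 (0 : E)) ℂ) where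
  carrier := {f | ∃ F : E → ℂ, AnalyticAt ℂ F 0 ∧ f = (F : Germ (𝓝 (0 : E)) ℂ)}
  mul_mem' := by
    rintro _ _ ⟨F, hF, rfl⟩ ⟨G, hG, rfl⟩
    exact ⟨F * G, hF.mul hG, rfl⟩
  add_mem' := by
    rintro _ _ ⟨F, hF, rfl⟩ ⟨G, hG, rfl⟩
    exact ⟨F + G, hF.add hG, rfl⟩
  algebraMap_mem' c := ⟨fun _ => c, analyticAt_const, germ_algebraMap _ c⟩

/-- The value of a germ at the origin. -/
def evalZero (E : Type) [NormedAddCommGroup E] [NormedSpace ℂ E] : HolGerm E →+* ℂ :=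
  (Germ.valueRingHom (X := E) (E := ℂ) (x := 0)).comp (HolGerm E).toSubring.subtype

/-- The maximal ideal: the germs that vanish at the origin. -/
def maxIdeal (E : Type) [NormedAddCommGroup E] [NormedSpace ℂ E] : Ideal (HolGerm E) :=
  RingHom.ker (evalZero E)

/-- The order of vanishing `ord_t f ∈ ℕ ∪ {∞}` of `f ∈ ℂ{t}`. -/
def ord (f : HolGerm ℂ) : ℕ∞ :=
  Quotient.liftOn' (f : Germ (𝓝 (0 : ℂ)) ℂ) (fun F => analyticOrderAt F 0)
    (fun _ _ h => analyticOrderAt_congr h)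

theorem ord_mk (F : ℂ → ℂ) (hF : AnalyticAt ℂ F 0) :
    ord ⟨(F : Germ (𝓝 (0 : ℂ)) ℂ), F, hF, rfl⟩ = analyticOrderAt F 0 := rfl

theorem le_ord_add (f g : HolGerm ℂ) : min (ord f) (ord g) ≤ ord (f + g) := by
  obtain ⟨_, F, hF, rfl⟩ := f
  obtain ⟨_, G, hG, rfl⟩ := g
  exact le_analyticOrderAt_add

theorem ord_mul (f g : HolGerm ℂ) : ord (f * g) = ord f + ord g := by
  obtain ⟨_, F, hF, rfl⟩ := f
  obtain ⟨_, G, hG, rfl⟩ := g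
  exact analyticOrderAt_mul hF hG

theorem ord_zero : ord 0 = ⊤ := by
  change analyticOrderAt (0 : ℂ → ℂ) 0 = ⊤
  simp [analyticOrderAt_eq_top]

/-- The pullback `f ↦ f ∘ γ` of germs along a holomorphic map germ `γ : (E, 0) → (E', 0)`. -/
def pullback {E E' : Type} [NormedAddCommGroup E] [NormedSpace ℂ E]
    [NormedAddCommGroup E'] [NormedSpace ℂ E'] (γ : E → E') (hγ : AnalyticAt ℂ γ 0)
    (h0 : γ 0 = 0) : HolGerm E' →ₐ[ℂ] HolGerm E where
  toFun f := ⟨(f : Germ (𝓝 (0 : E')) ℂ).compTendsto γ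
      (by simpa [h0] using hγ.continuousAt.tendsto), by
    obtain ⟨_, F, hF, rfl⟩ := f
    exact ⟨F ∘ γ, AnalyticAt.comp (by rwa [h0]) hγ, rfl⟩⟩
  map_one' := rfl
  map_mul' := by
    rintro ⟨_, F, hF, rfl⟩ ⟨_, G, hG, rfl⟩
    rfl
  map_zero' := rfl
  map_add' := by
    rintro ⟨_, F, hF, rfl⟩ ⟨_, G, hG, rfl⟩
    rfl
  commutes' c := by
    apply Subtype.ext
    have h : Tendsto γ (𝓝 0) (𝓝 0) := by simpa [h0] using hγ.continuousAt.tendsto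
    change (algebraMap ℂ (Germ (𝓝 (0 : E')) ℂ) c).compTendsto γ h =
      algebraMap ℂ (Germ (𝓝 (0 : E)) ℂ) c
    rw [germ_algebraMap, germ_algebraMap]
    rfl

/-! ### Reduced curve singularities -/

/-- A reduced complex curve singularity `(C, o) ⊂ (ℂ^N, 0)`, given by its ideal of germs: a proper
radical ideal all of whose minimal primes (the ideals of the branches) have one-dimensional
quotient. -/
structure CurveGerm (N : ℕ) where
  ideal : Ideal (HolGerm (Fin N → ℂ))
  ne_top : ideal ≠ ⊤
  isRadical : ideal.IsRadical
  dim_one : ∀ P ∈ ideal.minimalPrimes, ringKrullDim (HolGerm (Fin N → ℂ) ⧸ P) = 1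

/-- The multiplicity of the one-dimensional local ring `A = ℂ{x₁, …, x_N} / J` with maximal ideal
`𝔪`: the number `a` with `dim_ℂ (A / 𝔪 ^ k) = a * k + b` for all large `k`
(the leading coefficient of the Hilbert-Samuel polynomial). -/
def multiplicity {N : ℕ} (J : Ideal (HolGerm (Fin N → ℂ))) : ℕ :=
  sInf {a : ℕ | ∃ b : ℤ, ∀ᶠ k : ℕ in atTop,
    (Module.finrank ℂ ((HolGerm (Fin N → ℂ) ⧸ J) ⧸
      ((maxIdeal (Fin N → ℂ)).map (Ideal.Quotient.mk J)) ^ k) : ℤ) = a * k + b}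

namespace CurveGerm

variable {N : ℕ}

/-- The local algebra `𝓞 = 𝓞_{C,o}`. -/
abbrev LocalRing (C : CurveGerm N) : Type := HolGerm (Fin N → ℂ) ⧸ C.ideal

/-- A numbering `C₁, …, C_r` of the branches of `C` together with the normalization maps
`n_i : (ℂ, 0) → (C_i, o)`. The kernel of `n_i^*` is the ideal of the branch `C_i`, and
`n_i^* : 𝓞_i → ℂ{t}` exhibits `ℂ{t}` as the integral closure of `𝓞_i` in its field of fractions:
it is integral, and every element of `ℂ{t}` is a fraction of elements of `𝓞_i`. -/
structure Normalization (C : CurveGerm N) (r : ℕ) where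
  param : Fin r → ℂ → (Fin N → ℂ)
  analyticAt : ∀ i, AnalyticAt ℂ (param i) 0
  param_zero : ∀ i, param i 0 = 0
  ker_injective : Function.Injective fun i =>
    RingHom.ker (pullback (param i) (analyticAt i) (param_zero i))
  range_ker : (Set.range fun i => RingHom.ker (pullback (param i) (analyticAt i) (param_zero i))) =
    C.ideal.minimalPrimes
  integral : ∀ i, (pullback (param i) (analyticAt i) (param_zero i)).toRingHom.IsIntegral
  birational : ∀ i, ∀ f : HolGerm ℂ, ∃ a b : HolGerm (Fin N → ℂ),
    pullback (param i) (analyticAt i) (param_zero i) b ≠ 0 ∧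
    pullback (param i) (analyticAt i) (param_zero i) b * f =
      pullback (param i) (analyticAt i) (param_zero i) a

namespace Normalization

variable {C : CurveGerm N} {r : ℕ} (n : C.Normalization r)

/-- The ideal of the branch `C_i` in `ℂ{x₁, …, x_N}`. -/
def branchIdeal (i : Fin r) : Ideal (HolGerm (Fin N → ℂ)) :=
  RingHom.ker (pullback (n.param i) (n.analyticAt i) (n.param_zero i))

theorem ideal_le_branchIdeal (i : Fin r) : C.ideal ≤ n.branchIdeal i := by
  have h : n.branchIdeal i ∈ C.ideal.minimalPrimes := n.range_ker ▸ ⟨i, rfl⟩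
  exact h.1.2

/-- The map `𝓞 → 𝓞_i → ℂ{t_i}`, `g ↦ n_i^* g`. -/
def branchHom (i : Fin r) : C.LocalRing →ₐ[ℂ] HolGerm ℂ :=
  Ideal.Quotient.liftₐ C.ideal (pullback (n.param i) (n.analyticAt i) (n.param_zero i))
    (fun _ hg => n.ideal_le_branchIdeal i hg)

/-- The inclusion of `𝓞` into its normalization `∏ ℂ{t_i}`. -/
def normHom : C.LocalRing →ₐ[ℂ] (Fin r → HolGerm ℂ) := AlgHom.pi n.branchHom

/-- The valuation `𝔳_i : 𝓞 → ℕ ∪ {∞}`, `g ↦ ord_{t_i} (n_i^* g)`. -/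
def val (i : Fin r) (g : C.LocalRing) : ℕ∞ := ord (n.branchHom i g)

/-- The ideal `𝓕(ℓ) = {g ∈ 𝓞 : 𝔳_i(g) ≥ ℓ_i for all i}`. -/
def filtration (ℓ : Fin r → ℕ) : Ideal C.LocalRing where
  carrier := {g | ∀ i, (ℓ i : ℕ∞) ≤ n.val i g}
  add_mem' {a b} ha hb i := by
    have h := le_ord_add (n.branchHom i a) (n.branchHom i b)
    rw [← map_add] at h
    exact (le_min (ha i) (hb i)).trans h
  zero_mem' i := by
    simp [val, ord_zero]
  smul_mem' c x hx i := by
    have h : n.val i (c • x) = n.val i c + n.val i x := by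
      simp [val, ord_mul]
    rw [h]
    exact (hx i).trans le_add_self

/-- The Hilbert function `𝔥(ℓ) = dim_ℂ 𝓞 / 𝓕(ℓ)`. -/
def hilbert (ℓ : Fin r → ℕ) : ℕ := Module.finrank ℂ (C.LocalRing ⧸ n.filtration ℓ)

/-- The weight function `w(ℓ) = 2 𝔥(ℓ) - |ℓ|`. -/
def weight (ℓ : Fin r → ℕ) : ℤ := 2 * (n.hilbert ℓ : ℤ) - ∑ i, (ℓ i : ℤ)

/-- The semigroup of values: all `(𝔳_1(g), …, 𝔳_r(g))` with `g ∈ 𝓞` not a zero divisor. -/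
def semigroup : Set (Fin r → ℕ) :=
  {s | ∃ g ∈ nonZeroDivisors C.LocalRing, ∀ i, n.val i g = (s i : ℕ∞)}

/-- Generalized local minimum points of the weight function. -/
def IsGenLocalMin (p : Fin r → ℕ) : Prop :=
  ∀ i, 1 ≤ p i → n.weight p < n.weight (p - Pi.single i 1)

/-- Local minimum points of the weight function. -/
def IsLocalMin (p : Fin r → ℕ) : Prop :=
  (∀ i, n.weight p < n.weight (p + Pi.single i 1)) ∧
    ∀ i, 1 ≤ p i → n.weight p < n.weight (p - Pi.single i 1)

/-- The multiplicity vector `𝐦 = (m_1, …, m_r)`, where `m_i` is the multiplicity of the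
branch `C_i`. -/
def multVec : Fin r → ℕ := fun i => multiplicity (n.branchIdeal i)

/-- The conductor ideal `(𝓞 : ∏ ℂ{t_i})`, the elements of `𝓞` whose multiples by elements of the
normalization all lie in `𝓞`. -/
def conductorIdeal : Ideal C.LocalRing where
  carrier := {g | ∀ x : Fin r → HolGerm ℂ, n.normHom g * x ∈ n.normHom.range}
  add_mem' {a b} ha hb x := by
    rw [map_add, add_mul]
    exact add_mem (ha x) (hb x)
  zero_mem' x := by
    rw [map_zero, zero_mul]
    exact zero_mem _
  smul_mem' c g hg x := by
    rw [smul_eq_mul, map_mul, mul_assoc]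
    exact mul_mem ⟨c, rfl⟩ (hg x)

/-- The conductor `𝐜`: the conductor ideal is `(t_1^{c_1}, …, t_r^{c_r}) ∏ ℂ{t_i}`, so `c_i` is the
smallest value of `𝔳_i` on it. -/
def conductor : Fin r → ℕ := fun i =>
  sInf {k : ℕ | ∃ g ∈ n.conductorIdeal, n.val i g = (k : ℕ∞)}

end Normalization

end CurveGerm

end CurveSing

end

/-!
The argument is combinatorial once the Hilbert function `𝔥` is described by its *jumps*:
`𝔥(ℓ + e_i) - 𝔥(ℓ)` is `1` if some `g ∈ 𝓕(ℓ)` has `𝔳_i(g) = ℓ_i` (`Jump`) and `0` otherwise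
(`hilbert_add_single`). So `w` changes by `±1` at each step, `p` is a generalized local minimum
point when no jump leads to `p`, and it belongs to the semigroup when all steps leaving `p` are
jumps. Jumps add up, since functions can be multiplied (`Jump.add`).

*Symmetry.* If no jump leads to `p`, the steps `ℓ → ℓ + e_i` and `p - ℓ - e_i → p - ℓ` are never
both jumps. Hence `w(p - ℓ) - w(ℓ)` is nondecreasing in `ℓ` on `[0, p]`
(`IsGenLocalMin.weight_reflect_mono`). Its end values are `w(p)` and `-w(p)`, so `w(p) ≤ 0`, and
when `w(p) = 0` the difference vanishes identically.

*Part (a).* A general element of the maximal ideal has value `𝐦`, and `𝔥 = 1` on the nonzero points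
of `[0, 𝐦]`. By symmetry, the step `p - 𝐦 → p - 𝐦 + e_i` is a jump because `𝐦 - e_i → 𝐦` is not;
adding `𝐦` gives a jump at `p` (`IsGenLocalMin.jump_of_weight_eq_zero`).

*Part (b).* A nonzero local minimum point `p` of weight zero lies in the semigroup, so `𝐦 ≤ p`.
The gain `w(ℓ + 𝐦) - w(ℓ)` is nondecreasing in `ℓ`, is at most `|𝐦|`, has the parity of `|𝐦|`, and
equals `|𝐦| - 2` at `p - 𝐦` by symmetry. If it were `|𝐦| - 2` at `p` too, it would be constant on
`[p - 𝐦, p]`, and `p + 𝐦` would be a generalized local minimum point of weight `|𝐦| - 2 > 0`, which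
is impossible (`IsGenLocalMin.lt_weight_translate`). So the gain is `|𝐦|` from `p` on, every step
beyond `p` is a jump, and `p` is the conductor (`IsGenLocalMin.eq_conductor`).

Two facts link this to the geometry. First, `𝓞` contains `t ^ K ∏ ℂ{t_i}` for some `K`
(`exists_containsFrom`): if `x` in the maximal ideal has order `k` on `C_i`, then `ℂ{t_i}` is
generated over `ℂ{x}` by the powers `1, s, …, s ^ (k - 1)` of a `k`-th root `s` of `x`, so that
finitely many denominators suffice. Second, the multiplicity, defined by the Hilbert-Samuel
polynomial, is the sum of the smallest values `𝔳_i` on the maximal ideal `𝔪` (`multiplicity_eq`):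
`dim 𝓞 / 𝔪 ^ k` exceeds `𝔥(k𝐦)`, which is eventually affine of slope `|𝐦|`, by an amount that is
eventually nonincreasing, hence eventually constant. Applied to a single branch this identifies
`m_i`.
-/

noncomputable section

namespace CurveSing

/-! ### The ring `ℂ{t}` -/

theorem exists_rep {E : Type} [NormedAddCommGroup E] [NormedSpace ℂ E] (f : HolGerm E) :
    ∃ (F : E → ℂ) (hF : AnalyticAt ℂ F 0), f = ⟨(F : Germ (𝓝 (0 : E)) ℂ), F, hF, rfl⟩ := by
  obtain ⟨_, F, hF, rfl⟩ := f
  exact ⟨F, hF, rfl⟩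

/-- The `k`-th Taylor coefficient of a germ, up to the factor `k!`. -/
def taylorCoeff (k : ℕ) : HolGerm ℂ →ₗ[ℂ] ℂ where
  toFun f := Quotient.liftOn' (f : Germ (𝓝 (0 : ℂ)) ℂ) (fun F => iteratedDeriv k F 0)
    (fun _ _ h => Filter.EventuallyEq.iteratedDeriv_eq k h)
  map_add' := by
    rintro ⟨_, F, hF, rfl⟩ ⟨_, G, hG, rfl⟩
    exact iteratedDeriv_add hF.contDiffAt hG.contDiffAt
  map_smul' := by
    rintro c ⟨_, F, hF, rfl⟩
    exact iteratedDeriv_const_smul_field c F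

theorem le_ord_iff (k : ℕ) (f : HolGerm ℂ) : (k : ℕ∞) ≤ ord f ↔ ∀ j < k, taylorCoeff j f = 0 := by
  obtain ⟨F, hF, rfl⟩ := exists_rep f
  exact natCast_le_analyticOrderAt_iff_iteratedDeriv_eq_zero hF

theorem succ_le_ord_iff {k : ℕ} {f : HolGerm ℂ} (hf : (k : ℕ∞) ≤ ord f) :
    ((k + 1 : ℕ) : ℕ∞) ≤ ord f ↔ taylorCoeff k f = 0 := by
  rw [le_ord_iff] at hf ⊢
  refine ⟨fun h => h k (Nat.lt_succ_self k), fun h j hj => ?_⟩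
  rcases Nat.lt_succ_iff_lt_or_eq.mp hj with hj | rfl
  exacts [hf j hj, h]

theorem ord_eq_iff {k : ℕ} {f : HolGerm ℂ} (hf : (k : ℕ∞) ≤ ord f) :
    ord f = k ↔ taylorCoeff k f ≠ 0 := by
  rw [Ne, ← succ_le_ord_iff hf, Nat.cast_add, Nat.cast_one,
    ENat.add_one_le_iff (ENat.natCast_ne_top k), not_lt]
  exact ⟨fun h => h.le, fun h => le_antisymm h hf⟩

theorem ord_eq_top_iff {f : HolGerm ℂ} : ord f = ⊤ ↔ f = 0 := by
  refine ⟨fun h => ?_, fun h => h ▸ ord_zero⟩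
  obtain ⟨F, hF, rfl⟩ := exists_rep f
  rw [ord_mk F hF, analyticOrderAt_eq_top] at h
  exact Subtype.ext (Germ.coe_eq.mpr h)

theorem ord_one : ord 1 = 0 := by
  have h := ord_mk (fun _ => 1) analyticAt_const
  rw [analyticAt_const.analyticOrderAt_eq_zero.mpr one_ne_zero] at h
  exact h

theorem ord_pow (f : HolGerm ℂ) (k : ℕ) : ord (f ^ k) = k * ord f := by
  induction k with
  | zero => simp [ord_one]
  | succ k ih => rw [pow_succ, ord_mul, ih, Nat.cast_succ, add_mul, one_mul]

/-- The coordinate `t` of `ℂ{t}`. -/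
def coord : HolGerm ℂ := ⟨((id : ℂ → ℂ) : Germ (𝓝 (0 : ℂ)) ℂ), id, analyticAt_id, rfl⟩

theorem ord_coord_pow (k : ℕ) : ord (coord ^ k) = k := by
  rw [ord_pow, coord, ord_mk id analyticAt_id, analyticOrderAt_id, mul_one]

/-- Divisibility in the discrete valuation ring `ℂ{t}` is decided by the order. -/
theorem dvd_of_ord_le {f g : HolGerm ℂ} (h : ord g ≤ ord f) : g ∣ f := by
  rcases eq_or_ne (ord g) ⊤ with hg | hg
  · rw [hg, top_le_iff, ord_eq_top_iff] at h
    exact h ▸ dvd_zero g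
  obtain ⟨k, hk⟩ := ENat.ne_top_iff_exists.mp hg
  rw [← hk] at h
  obtain ⟨F, hF, rfl⟩ := exists_rep f
  obtain ⟨G, hG, rfl⟩ := exists_rep g
  rw [ord_mk F hF] at h
  rw [ord_mk G hG] at hk
  obtain ⟨V, hV, hV0, hGV⟩ := hG.analyticOrderAt_eq_natCast.mp hk.symm
  obtain ⟨U, hU, hFU⟩ := (natCast_le_analyticOrderAt hF).mp h
  refine ⟨⟨((fun z => U z / V z : ℂ → ℂ) : Germ (𝓝 (0 : ℂ)) ℂ), _, hU.div hV hV0, rfl⟩,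
    Subtype.ext (Germ.coe_eq.mpr ?_)⟩
  filter_upwards [hGV, hFU, hV.continuousAt.eventually_ne hV0] with z h1 h2 h3
  simp only [h1, h2, smul_eq_mul]
  field_simp

theorem one_le_ord_iff {f : HolGerm ℂ} : 1 ≤ ord f ↔ evalZero ℂ f = 0 := by
  obtain ⟨F, hF, rfl⟩ := exists_rep f
  rw [Order.one_le_iff_ne_zero, ord_mk F hF, hF.analyticOrderAt_ne_zero]
  rfl

theorem ord_algebraMap {c : ℂ} (hc : c ≠ 0) : ord (algebraMap ℂ (HolGerm ℂ) c) = 0 := by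
  by_contra h
  rw [← Ne, ← Order.one_le_iff_ne_zero] at h
  have h1 : (1 : ℕ∞) ≤ ord (algebraMap ℂ (HolGerm ℂ) c⁻¹ * algebraMap ℂ (HolGerm ℂ) c) := by
    rw [ord_mul]
    exact h.trans le_add_self
  rw [← map_mul, inv_mul_cancel₀ hc, map_one, ord_one] at h1
  exact absurd h1 (by norm_num)

instance : NoZeroDivisors (HolGerm ℂ) where
  eq_zero_or_eq_zero_of_mul_eq_zero {f g} h := by
    rw [← ord_eq_top_iff, ord_mul] at h
    exact (WithTop.add_eq_top.mp h).imp ord_eq_top_iff.mp ord_eq_top_iff.mp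

instance : Nontrivial (HolGerm ℂ) :=
  ⟨1, 0, fun h => by simpa [ord_one, ord_zero] using congrArg ord h⟩

theorem le_ord_sub {f g : HolGerm ℂ} {k : ℕ∞} (hf : k ≤ ord f) (hg : k ≤ ord g) :
    k ≤ ord (f - g) := by
  have h : k ≤ ord (-g) := by
    have h1 : -g = (-1) * g := by ring
    rw [h1, ord_mul]
    exact hg.trans le_add_self
  rw [sub_eq_add_neg]
  exact (le_min hf h).trans (le_ord_add f (-g))

theorem evalZero_algebraMap {E : Type} [NormedAddCommGroup E] [NormedSpace ℂ E] (c : ℂ) :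
    evalZero E (algebraMap ℂ (HolGerm E) c) = c := by
  change Germ.value (algebraMap ℂ (Germ (𝓝 (0 : E)) ℂ) c) = c
  rw [germ_algebraMap]
  rfl

theorem evalZero_pullback {E E' : Type} [NormedAddCommGroup E] [NormedSpace ℂ E]
    [NormedAddCommGroup E'] [NormedSpace ℂ E'] (γ : E → E') (hγ : AnalyticAt ℂ γ 0)
    (h0 : γ 0 = 0) (f : HolGerm E') : evalZero E (pullback γ hγ h0 f) = evalZero E' f := by
  obtain ⟨F, hF, rfl⟩ := exists_rep f
  change F (γ 0) = F 0
  rw [h0]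

/-! ### `ℂ{t}` is finite over `ℂ{x}` -/

/-- A convergent power series splits according to the residue classes of the exponents. -/
theorem exists_residue_decomposition {F : ℂ → ℂ} (hF : AnalyticAt ℂ F 0) {k : ℕ} (hk : 0 < k) :
    ∃ φ : ℕ → ℂ → ℂ, (∀ j, AnalyticAt ℂ (φ j) 0) ∧
      ∀ᶠ z in 𝓝 (0 : ℂ), F z = ∑ j ∈ Finset.range k, z ^ j * φ j (z ^ k) := by
  obtain ⟨p, hp⟩ := hF
  obtain ⟨r, hr0, hr⟩ := ENNReal.lt_iff_exists_nnreal_btwn.mp hp.radius_pos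
  rw [ENNReal.coe_pos] at hr0
  obtain ⟨C, hC, hb⟩ := p.norm_mul_pow_le_of_lt_radius hr
  let q : ℕ → FormalMultilinearSeries ℂ ℂ ℂ := fun j =>
    FormalMultilinearSeries.ofScalars ℂ fun n => p.coeff (k * n + j)
  have hq : ∀ j, HasFPowerSeriesOnBall (q j).sum (q j) 0 (q j).radius := fun j => by
    apply FormalMultilinearSeries.hasFPowerSeriesOnBall
    refine lt_of_lt_of_le (ENNReal.coe_pos.mpr (pow_pos hr0 k))
      ((q j).le_radius_of_bound (C / (r : ℝ) ^ j) fun n => ?_)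
    rw [le_div_iff₀ (pow_pos (by exact_mod_cast hr0) j),
      FormalMultilinearSeries.norm_apply_eq_norm_coef,
      FormalMultilinearSeries.coeff_ofScalars, NNReal.coe_pow, ← pow_mul, mul_assoc, ← pow_add,
      ← FormalMultilinearSeries.norm_apply_eq_norm_coef]
    exact hb _
  refine ⟨fun j => (q j).sum, fun j => (hq j).analyticAt, ?_⟩
  have hpow : Tendsto (fun z : ℂ => z ^ k) (𝓝 0) (𝓝 0) := by
    have h := (continuous_pow k).tendsto (0 : ℂ)
    rwa [zero_pow hk.ne'] at h
  have hev : ∀ᶠ z in 𝓝 (0 : ℂ), ∀ j ∈ Finset.range k,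
      HasSum (fun n => (q j n) fun _ => z ^ k) ((q j).sum (0 + z ^ k)) := by
    rw [Filter.eventually_all_finset]
    exact fun j _ => hpow.eventually (hq j).hasFPowerSeriesAt.eventually_hasSum
  filter_upwards [hp.eventually_hasSum, hev] with z hz hqz
  rw [zero_add] at hz
  refine hz.unique ?_
  have hj : ∀ j ∈ Finset.range k, HasSum
      (fun n => if n % k = j then (p n) fun _ => z else 0) (z ^ j * (q j).sum (z ^ k)) := by
    intro j hj
    have hjk := Finset.mem_range.mp hj
    have hinj : Function.Injective fun n => k * n + j := fun a b hab =>
      Nat.eq_of_mul_eq_mul_left hk (Nat.add_right_cancel hab)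
    rw [← hinj.hasSum_iff]
    · have h := (hqz j hj).mul_left (z ^ j)
      rw [zero_add] at h
      have hfun : ((fun n => if n % k = j then (p n) fun _ => z else 0) ∘ fun n => k * n + j) =
          fun n => z ^ j * (q j n) fun _ => z ^ k := by
        funext n
        simp only [Function.comp_apply, Nat.mul_add_mod, Nat.mod_eq_of_lt hjk, if_true,
          FormalMultilinearSeries.apply_eq_prod_smul_coeff, q,
          FormalMultilinearSeries.coeff_ofScalars, Finset.prod_const, Finset.card_univ,
          Fintype.card_fin, smul_eq_mul]
        ring
      rw [hfun]
      exact h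
    · intro n hn
      refine if_neg fun h => hn ⟨n / k, ?_⟩
      rw [← h]
      exact Nat.div_add_mod n k
  have hfun : (fun n => (p n) fun _ => z) =
      fun n => ∑ j ∈ Finset.range k, if n % k = j then (p n) fun _ => z else 0 := by
    funext n
    rw [Finset.sum_ite_eq, if_pos (Finset.mem_range.mpr (Nat.mod_lt n hk))]
  rw [hfun]
  exact hasSum_sum hj

/-- A function of order `k` is the `k`-th power of a uniformizer. -/
theorem exists_uniformizer_pow {ξ : ℂ → ℂ} (hξ : AnalyticAt ℂ ξ 0) {k : ℕ} (hk : 0 < k)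
    (h : analyticOrderAt ξ 0 = k) :
    ∃ s : ℂ → ℂ, AnalyticAt ℂ s 0 ∧ s 0 = 0 ∧ deriv s 0 ≠ 0 ∧ ∀ᶠ z in 𝓝 (0 : ℂ), ξ z = s z ^ k := by
  obtain ⟨u, hu, hu0, hξu⟩ := hξ.analyticOrderAt_eq_natCast.mp h
  obtain ⟨c, hc⟩ := IsAlgClosed.exists_pow_nat_eq (u 0) hk
  have hc0 : c ≠ 0 := fun h => hu0 (by rw [← hc, h, zero_pow hk.ne'])
  -- Dividing by `u 0` first moves the base point of the `k`-th root to `1`, off the branch cut.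
  let v : ℂ → ℂ := fun z => c * (u z / u 0) ^ ((k : ℂ)⁻¹)
  have hv : AnalyticAt ℂ v 0 := analyticAt_const.mul
    ((hu.div analyticAt_const hu0).cpow analyticAt_const (by simp [hu0]))
  have hv0 : v 0 = c := by simp [v, hu0]
  refine ⟨fun z => z * v z, analyticAt_id.mul hv, by simp, ?_, ?_⟩
  · have hd : HasDerivAt (fun z => z * v z) (1 * v 0 + 0 * deriv v 0) 0 :=
      (hasDerivAt_id (0 : ℂ)).mul hv.differentiableAt.hasDerivAt
    rw [hd.deriv, hv0]
    simpa using hc0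
  · filter_upwards [hξu] with z hz
    rw [hz, sub_zero, smul_eq_mul, mul_pow, mul_pow, hc, Complex.cpow_nat_inv_pow _ hk.ne',
      mul_div_cancel₀ _ hu0]

/-- If `ξ` has order `k > 0`, then every analytic `f` is a combination of `1, s, …, s ^ (k - 1)`
with coefficients that are analytic functions of `ξ`, for a suitable uniformizer `s`. -/
theorem exists_finite_generation {ξ : ℂ → ℂ} (hξ : AnalyticAt ℂ ξ 0) {k : ℕ} (hk : 0 < k)
    (h : analyticOrderAt ξ 0 = k) :
    ∃ s : ℂ → ℂ, AnalyticAt ℂ s 0 ∧ ∀ f : ℂ → ℂ, AnalyticAt ℂ f 0 →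
      ∃ φ : ℕ → ℂ → ℂ, (∀ j, AnalyticAt ℂ (φ j) 0) ∧
        ∀ᶠ z in 𝓝 (0 : ℂ), f z = ∑ j ∈ Finset.range k, s z ^ j * φ j (ξ z) := by
  obtain ⟨s, hs, hs0, hs', hξs⟩ := exists_uniformizer_pow hξ hk h
  refine ⟨s, hs, fun f hf => ?_⟩
  let σ := hs.hasStrictDerivAt.localInverse _ _ _ hs'
  have hσ : AnalyticAt ℂ σ 0 := hs0 ▸ hs.analyticAt_localInverse hs'
  have hleft : ∀ᶠ z in 𝓝 (0 : ℂ), σ (s z) = z := hs.hasStrictDerivAt.eventually_left_inverse hs'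
  have hσ0 : σ 0 = 0 := by simpa only [hs0] using hleft.self_of_nhds
  obtain ⟨φ, hφ, hdec⟩ := exists_residue_decomposition
    (AnalyticAt.comp (g := f) (f := σ) (by rwa [hσ0]) hσ) hk
  refine ⟨φ, hφ, ?_⟩
  have hst : Tendsto s (𝓝 0) (𝓝 0) := by simpa only [hs0] using hs.continuousAt.tendsto
  filter_upwards [hst.eventually hdec, hleft, hξs] with z h1 h2 h3
  rw [Function.comp_apply, h2] at h1
  rw [h1, h3]

/-! ### Values on the local ring -/

/-- If the pullback of `g` to `(ℂ, 0)` has finite positive order, then `ℂ{t}` is a finite module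
over the pullbacks of the power series in `g`. -/
theorem exists_finite_generation_pullback {N : ℕ} {γ : ℂ → Fin N → ℂ} (hγ : AnalyticAt ℂ γ 0)
    (h0 : γ 0 = 0) (g : HolGerm (Fin N → ℂ)) {k : ℕ} (hk : 0 < k)
    (hg : ord (pullback γ hγ h0 g) = k) :
    ∃ s : HolGerm ℂ, ∀ f : HolGerm ℂ, ∃ a : ℕ → HolGerm (Fin N → ℂ),
      f = ∑ j ∈ Finset.range k, s ^ j * pullback γ hγ h0 (a j) := by
  obtain ⟨X, hX, rfl⟩ := exists_rep g
  have hXγ : AnalyticAt ℂ (X ∘ γ) 0 := AnalyticAt.comp (by rwa [h0]) hγ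
  replace hg : analyticOrderAt (X ∘ γ) 0 = k := hg
  have hX0 : X 0 = 0 := by
    have h := hXγ.analyticOrderAt_ne_zero.mp (by rw [hg]; exact_mod_cast hk.ne')
    rwa [Function.comp_apply, h0] at h
  obtain ⟨s, hs, hgen⟩ := exists_finite_generation hXγ hk hg
  refine ⟨⟨(s : Germ (𝓝 (0 : ℂ)) ℂ), s, hs, rfl⟩, fun f => ?_⟩
  obtain ⟨F, hF, rfl⟩ := exists_rep f
  obtain ⟨φ, hφ, hdec⟩ := hgen F hF
  refine ⟨fun j => ⟨((φ j ∘ X : (Fin N → ℂ) → ℂ) : Germ (𝓝 (0 : Fin N → ℂ)) ℂ), _,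
    AnalyticAt.comp (by rw [hX0]; exact hφ j) hX, rfl⟩, Subtype.ext ?_⟩
  have hsum : ∀ t : Finset ℕ, ((∑ j ∈ t, (⟨(s : Germ (𝓝 (0 : ℂ)) ℂ), s, hs, rfl⟩ : HolGerm ℂ) ^ j *
      pullback γ hγ h0 ⟨((φ j ∘ X : (Fin N → ℂ) → ℂ) : Germ (𝓝 (0 : Fin N → ℂ)) ℂ), _,
        AnalyticAt.comp (by rw [hX0]; exact hφ j) hX, rfl⟩ : HolGerm ℂ) : Germ (𝓝 (0 : ℂ)) ℂ) =
      ((fun z => ∑ j ∈ t, s z ^ j * φ j (X (γ z)) : ℂ → ℂ) : Germ (𝓝 (0 : ℂ)) ℂ) := by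
    intro t
    induction t using Finset.induction_on with
    | empty => rfl
    | insert a t ha ih =>
      simp only [Finset.sum_insert ha]
      rw [Subalgebra.coe_add, ih]
      rfl
  rw [hsum]
  exact Germ.coe_eq.mpr hdec

namespace CurveGerm

variable {N : ℕ}

/-- A shortcut to the commutative ring structure of `𝓞`, which unification does not find on its
own through the subalgebra of holomorphic germs. -/
instance localRingCommSemiring (C : CurveGerm N) : CommSemiring C.LocalRing :=
  Ideal.Quotient.commSemiring C.ideal

/-- The maximal ideal of the local algebra of a curve. -/
def localMaxIdeal (C : CurveGerm N) : Ideal C.LocalRing :=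
  (maxIdeal (Fin N → ℂ)).map (Ideal.Quotient.mk C.ideal)

namespace Normalization

variable {C : CurveGerm N} {r : ℕ} (n : C.Normalization r)

theorem branchHom_mk (i : Fin r) (g : HolGerm (Fin N → ℂ)) :
    n.branchHom i (Ideal.Quotient.mk C.ideal g) =
      pullback (n.param i) (n.analyticAt i) (n.param_zero i) g := rfl

theorem nonempty_index (n : C.Normalization r) : Nonempty (Fin r) := by
  obtain ⟨P, hP⟩ := Ideal.nonempty_minimalPrimes C.ne_top
  rw [← n.range_ker] at hP
  obtain ⟨i, -⟩ := hP
  exact ⟨i⟩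

/-- As `C` is reduced, a function vanishes on `C` if it vanishes on every branch. -/
theorem eq_zero_of_forall_branchHom_eq_zero {g : C.LocalRing} (h : ∀ i, n.branchHom i g = 0) :
    g = 0 := by
  obtain ⟨g, rfl⟩ := Ideal.Quotient.mk_surjective g
  rw [Ideal.Quotient.eq_zero_iff_mem, ← C.isRadical.radical, ← Ideal.sInf_minimalPrimes,
    ← n.range_ker, Ideal.mem_sInf]
  rintro _ ⟨i, rfl⟩
  exact h i

theorem normHom_injective : Function.Injective n.normHom :=
  (injective_iff_map_eq_zero n.normHom).mpr fun _ hg =>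
    n.eq_zero_of_forall_branchHom_eq_zero fun i => congrFun hg i

theorem val_mul (i : Fin r) (g g' : C.LocalRing) : n.val i (g * g') = n.val i g + n.val i g' := by
  simp [val, ord_mul]

theorem mem_filtration {ℓ : Fin r → ℕ} {g : C.LocalRing} :
    g ∈ n.filtration ℓ ↔ ∀ i, (ℓ i : ℕ∞) ≤ n.val i g := Iff.rfl

theorem filtration_anti {ℓ ℓ' : Fin r → ℕ} (h : ℓ ≤ ℓ') : n.filtration ℓ' ≤ n.filtration ℓ :=
  fun _ hg i => (Nat.cast_le.mpr (h i)).trans (hg i)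

theorem filtration_zero : n.filtration 0 = ⊤ :=
  Ideal.ext fun g => by simp [mem_filtration]

theorem mul_mem_filtration {ℓ ℓ' : Fin r → ℕ} {g g' : C.LocalRing} (h : g ∈ n.filtration ℓ)
    (h' : g' ∈ n.filtration ℓ') : g * g' ∈ n.filtration (ℓ + ℓ') := fun i => by
  rw [val_mul, Pi.add_apply, Nat.cast_add]
  exact add_le_add (h i) (h' i)

/-- `g` belongs to the maximal ideal as soon as it vanishes at the origin of one branch. -/
theorem mem_localMaxIdeal_iff (i : Fin r) (g : C.LocalRing) :
    g ∈ C.localMaxIdeal ↔ 1 ≤ n.val i g := by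
  constructor
  · intro hg
    have h : C.localMaxIdeal ≤ (RingHom.ker (evalZero ℂ)).comap (n.branchHom i) := by
      refine Ideal.map_le_iff_le_comap.mpr fun g hg => ?_
      change evalZero ℂ (pullback _ (n.analyticAt i) (n.param_zero i) g) = 0
      rwa [evalZero_pullback]
    exact one_le_ord_iff.mpr (h hg)
  · intro hg
    obtain ⟨g, rfl⟩ := Ideal.Quotient.mk_surjective g
    refine Ideal.mem_map_of_mem _ ?_
    have h := one_le_ord_iff.mp hg
    rwa [branchHom_mk, evalZero_pullback] at h

/-- `g - g(0)` belongs to the maximal ideal. -/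
theorem exists_sub_algebraMap_mem (g : C.LocalRing) :
    ∃ c : ℂ, g - algebraMap ℂ C.LocalRing c ∈ C.localMaxIdeal := by
  obtain ⟨g, rfl⟩ := Ideal.Quotient.mk_surjective g
  refine ⟨evalZero _ g, Ideal.mem_map_of_mem (x := g - algebraMap ℂ _ (evalZero _ g)) _ ?_⟩
  change evalZero _ (g - algebraMap ℂ _ (evalZero _ g)) = 0
  rw [map_sub, evalZero_algebraMap, sub_self]

/-- A branch is not constant, so some function in the maximal ideal has a finite value on it. -/
theorem exists_mem_localMaxIdeal_val_eq (i : Fin r) :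
    ∃ k : ℕ, ∃ g ∈ C.localMaxIdeal, n.val i g = k := by
  by_contra! hcon
  have h0 : ∀ g ∈ C.localMaxIdeal, n.branchHom i g = 0 := fun g hg => by
    by_contra hne
    obtain ⟨k, hk⟩ := ENat.ne_top_iff_exists.mp (fun h => hne (ord_eq_top_iff.mp h))
    exact hcon k g hg hk.symm
  -- All pullbacks are then constants, and the coordinate `t` is not a quotient of constants.
  have hconst : ∀ g, ∃ c, n.branchHom i g = algebraMap ℂ (HolGerm ℂ) c := fun g => by
    obtain ⟨c, hc⟩ := exists_sub_algebraMap_mem g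
    have h := h0 _ hc
    rw [map_sub, sub_eq_zero, AlgHom.commutes] at h
    exact ⟨c, h⟩
  obtain ⟨a, b, hb, hab⟩ := n.birational i coord
  obtain ⟨c, hc⟩ := hconst (Ideal.Quotient.mk _ a)
  obtain ⟨d, hd⟩ := hconst (Ideal.Quotient.mk _ b)
  rw [branchHom_mk] at hc hd
  rw [hc, hd] at hab
  rw [hd] at hb
  have hd0 : d ≠ 0 := fun h => hb (by rw [h, map_zero])
  have h1 := congrArg ord hab
  have hcoord : ord coord = 1 := by simpa using ord_coord_pow 1
  rw [ord_mul, ord_algebraMap hd0, zero_add, hcoord] at h1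
  rcases eq_or_ne c 0 with rfl | hc0
  · rw [map_zero, ord_zero] at h1
    exact absurd h1 (by simp)
  · rw [ord_algebraMap hc0] at h1
    exact absurd h1 (by simp)

/-- The smallest value `𝔳_i` takes on the maximal ideal. -/
def minVal (i : Fin r) : ℕ := sInf {k : ℕ | ∃ g ∈ C.localMaxIdeal, n.val i g = k}

theorem exists_val_eq_minVal (i : Fin r) : ∃ g ∈ C.localMaxIdeal, n.val i g = n.minVal i :=
  Nat.sInf_mem (s := {k : ℕ | ∃ g ∈ C.localMaxIdeal, n.val i g = k})
    (n.exists_mem_localMaxIdeal_val_eq i)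

theorem minVal_le_val {g : C.LocalRing} (hg : g ∈ C.localMaxIdeal) (i : Fin r) :
    (n.minVal i : ℕ∞) ≤ n.val i g := by
  rcases eq_or_ne (n.val i g) ⊤ with h | h
  · simp [h]
  · obtain ⟨k, hk⟩ := ENat.ne_top_iff_exists.mp h
    rw [← hk, Nat.cast_le]
    exact Nat.sInf_le ⟨g, hg, hk.symm⟩

theorem one_le_minVal (i : Fin r) : 1 ≤ n.minVal i := by
  obtain ⟨g, hg, h⟩ := n.exists_val_eq_minVal i
  rw [mem_localMaxIdeal_iff n i, h] at hg
  exact_mod_cast hg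

/-! ### The conductor of a branch and of the curve -/

/-- `𝓞_i` contains a nonzero ideal of `ℂ{t_i}`: a common denominator of finitely many module
generators of `ℂ{t_i}`. -/
theorem exists_denominator (i : Fin r) : ∃ B : C.LocalRing, n.branchHom i B ≠ 0 ∧
    ∀ f : HolGerm ℂ, ∃ a : C.LocalRing, n.branchHom i a = n.branchHom i B * f := by
  obtain ⟨x, hx, hxi⟩ := n.exists_val_eq_minVal i
  obtain ⟨x, rfl⟩ := Ideal.Quotient.mk_surjective x
  obtain ⟨s, hs⟩ := exists_finite_generation_pullback (n.analyticAt i) (n.param_zero i) x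
    (n.one_le_minVal i) hxi
  choose a b hb hab using fun j : ℕ => n.birational i (s ^ j)
  refine ⟨∏ j ∈ Finset.range (n.minVal i), Ideal.Quotient.mk _ (b j), ?_, fun f => ?_⟩
  · rw [map_prod, Finset.prod_ne_zero_iff]
    exact fun j _ => hb j
  · obtain ⟨e, rfl⟩ := hs f
    rw [Finset.mul_sum]
    refine (n.branchHom i).range.sum_mem fun j hj => ?_
    have h : n.branchHom i (∏ j ∈ Finset.range (n.minVal i), Ideal.Quotient.mk _ (b j)) *
        (s ^ j * pullback (n.param i) (n.analyticAt i) (n.param_zero i) (e j)) =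
        n.branchHom i ((∏ l ∈ (Finset.range (n.minVal i)).erase j, Ideal.Quotient.mk _ (b l)) *
          Ideal.Quotient.mk _ (a j) * Ideal.Quotient.mk _ (e j)) := by
      rw [← Finset.mul_prod_erase _ _ hj, map_mul, map_mul, map_mul, branchHom_mk, branchHom_mk,
        branchHom_mk, ← hab]
      ring
    rw [h]
    exact ⟨_, rfl⟩

/-- Distinct branches are separated by a function that vanishes on all branches but one. -/
theorem exists_separating (i : Fin r) : ∃ u : C.LocalRing, n.branchHom i u ≠ 0 ∧
    ∀ j ≠ i, n.branchHom j u = 0 := by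
  have hsep : ∀ j : Fin r, ∃ u : C.LocalRing, n.branchHom i u ≠ 0 ∧
      (j ≠ i → n.branchHom j u = 0) := fun j => by
    rcases eq_or_ne j i with rfl | hji
    · exact ⟨1, by simp, fun h => absurd rfl h⟩
    have hi : n.branchIdeal i ∈ C.ideal.minimalPrimes := n.range_ker ▸ ⟨i, rfl⟩
    have hj : n.branchIdeal j ∈ C.ideal.minimalPrimes := n.range_ker ▸ ⟨j, rfl⟩
    have hnle : ¬ n.branchIdeal j ≤ n.branchIdeal i := fun h =>
      hji (n.ker_injective (le_antisymm h (hi.2 hj.1 h)))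
    obtain ⟨u, huj, hui⟩ := SetLike.not_le_iff_exists.mp hnle
    exact ⟨Ideal.Quotient.mk _ u, hui, fun _ => huj⟩
  choose u hu hu' using hsep
  refine ⟨∏ j, u j, ?_, fun j hj => ?_⟩
  · rw [map_prod, Finset.prod_ne_zero_iff]
    exact fun j _ => hu j
  · rw [map_prod]
    exact Finset.prod_eq_zero (Finset.mem_univ j) (hu' j hj)

/-- `K` lies beyond the conductor: `t ^ K` times the normalization is contained in the local
algebra. -/
def ContainsFrom (K : Fin r → ℕ) : Prop :=
  ∀ y : Fin r → HolGerm ℂ, (∀ i, (K i : ℕ∞) ≤ ord (y i)) → y ∈ n.normHom.range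

/-- The local algebra contains all elements of the normalization of sufficiently high order. -/
theorem exists_containsFrom : ∃ K : Fin r → ℕ, n.ContainsFrom K := by
  choose B hB hBf using n.exists_denominator
  choose u hu hu' using n.exists_separating
  have hne : ∀ i, n.branchHom i (u i * B i) ≠ 0 := fun i => by
    rw [map_mul]
    exact mul_ne_zero (hu i) (hB i)
  choose K hK using fun i => ENat.ne_top_iff_exists.mp (fun h => hne i (ord_eq_top_iff.mp h))
  refine ⟨K, fun y hy => ?_⟩
  choose q hq using fun i => dvd_of_ord_le ((hK i) ▸ hy i)
  choose a ha using fun i => hBf i (q i)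
  refine ⟨∑ i, u i * a i, funext fun j => ?_⟩
  change n.branchHom j (∑ i, u i * a i) = y j
  rw [map_sum, Finset.sum_eq_single j, map_mul, ha, hq j, map_mul, mul_assoc]
  · intro i _ hij
    rw [map_mul, hu' i j hij.symm, zero_mul]
  · exact fun h => absurd (Finset.mem_univ j) h

/-! ### The Hilbert function and its jumps -/

/-- The Hilbert function jumps at `ℓ` in direction `i`: some element of `𝓕(ℓ)` has `𝔳_i`-value
exactly `ℓ_i`. -/
def Jump (ℓ : Fin r → ℕ) (i : Fin r) : Prop := ∃ g ∈ n.filtration ℓ, n.val i g = ℓ i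

theorem jump_zero (i : Fin r) : n.Jump 0 i :=
  ⟨1, by simp [filtration_zero], by simp [val, ord_one]⟩

variable {n} in
theorem Jump.add {ℓ ℓ' : Fin r → ℕ} {i : Fin r} (h : n.Jump ℓ i) (h' : n.Jump ℓ' i) :
    n.Jump (ℓ + ℓ') i := by
  obtain ⟨g, hg, hgi⟩ := h
  obtain ⟨g', hg', hgi'⟩ := h'
  exact ⟨g * g', n.mul_mem_filtration hg hg', by
    rw [val_mul, hgi, hgi', Pi.add_apply, Nat.cast_add]⟩

/-- The leading coefficient along the branch `C_i` of the elements of `𝓕(ℓ)`. -/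
def leadCoeff (ℓ : Fin r → ℕ) (i : Fin r) : C.LocalRing →ₗ[ℂ] ℂ :=
  (taylorCoeff (ℓ i)).comp (n.branchHom i).toLinearMap

theorem val_eq_iff {ℓ : Fin r → ℕ} {g : C.LocalRing} (hg : g ∈ n.filtration ℓ) (i : Fin r) :
    n.val i g = ℓ i ↔ n.leadCoeff ℓ i g ≠ 0 := ord_eq_iff (hg i)

theorem mem_filtration_add_single {ℓ : Fin r → ℕ} {i : Fin r} {g : C.LocalRing} :
    g ∈ n.filtration (ℓ + Pi.single i 1) ↔ g ∈ n.filtration ℓ ∧ n.leadCoeff ℓ i g = 0 := by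
  constructor
  · intro hg
    have h := n.filtration_anti (le_self_add (a := ℓ) (b := Pi.single i 1)) hg
    refine ⟨h, (succ_le_ord_iff (h i)).mp ?_⟩
    have h1 := hg i
    rw [Pi.add_apply, Pi.single_eq_same] at h1
    exact h1
  · rintro ⟨hg, h0⟩ j
    rcases eq_or_ne j i with rfl | hj
    · simpa [val] using (succ_le_ord_iff (hg j)).mpr h0
    · simpa [hj] using hg j

theorem jump_iff_exists_leadCoeff_ne_zero {ℓ : Fin r → ℕ} {i : Fin r} :
    n.Jump ℓ i ↔ ∃ g ∈ n.filtration ℓ, n.leadCoeff ℓ i g ≠ 0 :=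
  exists_congr fun _ => and_congr_right fun hg => n.val_eq_iff hg i

open Classical in
/-- Intersecting a subspace of finite codimension with a hyperplane raises the codimension by one,
unless the subspace lies in the hyperplane. -/
theorem finrank_quotient_inf_ker {V : Type*} [AddCommGroup V] [Module ℂ V] {W W' : Submodule ℂ V}
    {φ : V →ₗ[ℂ] ℂ} (hW' : ∀ v, v ∈ W' ↔ v ∈ W ∧ φ v = 0) [Module.Finite ℂ (V ⧸ W)] :
    Module.Finite ℂ (V ⧸ W') ∧ Module.finrank ℂ (V ⧸ W') =
      Module.finrank ℂ (V ⧸ W) + if ∃ w ∈ W, φ w ≠ 0 then 1 else 0 := by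
  split_ifs with h
  · obtain ⟨w, hw, hφ⟩ := h
    let Ψ : V →ₗ[ℂ] (V ⧸ W) × ℂ := W.mkQ.prod φ
    have hker : W' = LinearMap.ker Ψ := by
      ext v
      rw [hW', LinearMap.ker_prod, Submodule.mem_inf, Submodule.ker_mkQ, LinearMap.mem_ker]
    have hsurj : Function.Surjective Ψ := by
      rintro ⟨v, c⟩
      obtain ⟨v, rfl⟩ := W.mkQ_surjective v
      refine ⟨v + ((c - φ v) / φ w) • w, Prod.ext ?_ ?_⟩
      · change W.mkQ (v + ((c - φ v) / φ w) • w) = W.mkQ v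
        rw [map_add, map_smul, W.mkQ_apply w, (Submodule.Quotient.mk_eq_zero W).mpr hw, smul_zero,
          add_zero]
      · change φ (v + ((c - φ v) / φ w) • w) = c
        rw [map_add, map_smul, smul_eq_mul, div_mul_cancel₀ _ hφ, add_sub_cancel]
    let e : (V ⧸ W') ≃ₗ[ℂ] (V ⧸ W) × ℂ :=
      (Submodule.quotEquivOfEq _ _ hker).trans (Ψ.quotKerEquivOfSurjective hsurj)
    refine ⟨Module.Finite.equiv e.symm, ?_⟩
    rw [e.finrank_eq, Module.finrank_prod, Module.finrank_self]
  · push Not at h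
    obtain rfl : W' = W := Submodule.ext fun v =>
      (hW' v).trans ⟨fun hv => hv.1, fun hv => ⟨hv, h v hv⟩⟩
    exact ⟨inferInstance, rfl⟩

/-- Induction along the lattice points between `a` and `b`. -/
theorem lattice_induction {P : (Fin r → ℕ) → Prop} {a b : Fin r → ℕ} (hab : a ≤ b) (ha : P a)
    (step : ∀ ℓ i, a ≤ ℓ → ℓ + Pi.single i 1 ≤ b → P ℓ → P (ℓ + Pi.single i 1)) : P b := by
  induction hk : ∑ i, (b i - a i) generalizing a with
  | zero =>
    have h : a = b := le_antisymm hab fun i =>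
      Nat.sub_eq_zero_iff_le.mp (Finset.sum_eq_zero_iff.mp hk i (Finset.mem_univ i))
    exact h ▸ ha
  | succ k ih =>
    obtain ⟨i, -, hi⟩ := Finset.exists_ne_zero_of_sum_ne_zero (hk.trans_ne (Nat.succ_ne_zero k))
    have hle : a + Pi.single i 1 ≤ b := fun j => by
      rcases eq_or_ne j i with rfl | hj
      · simpa using Nat.lt_of_sub_ne_zero hi
      · simpa [hj] using hab j
    refine ih hle (step a i le_rfl hle ha)
      (fun ℓ j hℓ hj hP => step ℓ j ((le_self_add).trans hℓ) hj hP) ?_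
    have h : ∑ j, (b j - a j) = ∑ j, ((b j - (a + Pi.single i 1 : Fin r → ℕ) j) +
        (Pi.single i 1 : Fin r → ℕ) j) := by
      refine Finset.sum_congr rfl fun j _ => ?_
      have := hab j
      have := hle j
      simp only [Pi.add_apply] at *
      omega
    rw [Finset.sum_add_distrib, Finset.sum_pi_single', if_pos (Finset.mem_univ i), hk] at h
    exact (Nat.succ_injective h).symm

/-- `𝓕(ℓ)` as a complex subspace of `𝓞`. -/
abbrev filtrationSubspace (ℓ : Fin r → ℕ) : Submodule ℂ C.LocalRing :=
  (n.filtration ℓ).restrictScalars ℂ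

theorem finrank_quotient_filtrationSubspace (ℓ : Fin r → ℕ) :
    Module.finrank ℂ (C.LocalRing ⧸ n.filtrationSubspace ℓ) = n.hilbert ℓ :=
  (Submodule.Quotient.restrictScalarsEquiv ℂ (n.filtration ℓ)).finrank_eq

theorem subsingleton_quotient_filtrationSubspace_zero :
    Subsingleton (C.LocalRing ⧸ n.filtrationSubspace 0) := by
  rw [Submodule.Quotient.subsingleton_iff, filtrationSubspace, filtration_zero,
    Submodule.restrictScalars_top]

instance finite_quotient_filtrationSubspace (ℓ : Fin r → ℕ) :
    Module.Finite ℂ (C.LocalRing ⧸ n.filtrationSubspace ℓ) := by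
  refine lattice_induction (P := fun ℓ => Module.Finite ℂ (C.LocalRing ⧸ n.filtrationSubspace ℓ))
    (zero_le (a := ℓ)) ?_ fun ℓ i _ _ h =>
      (finrank_quotient_inf_ker (W := n.filtrationSubspace ℓ) (φ := n.leadCoeff ℓ i)
        fun g => n.mem_filtration_add_single).1
  have := n.subsingleton_quotient_filtrationSubspace_zero
  exact ⟨⟨∅, Subsingleton.elim _ _⟩⟩

theorem hilbert_zero : n.hilbert 0 = 0 := by
  have := n.subsingleton_quotient_filtrationSubspace_zero
  rw [← finrank_quotient_filtrationSubspace]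
  exact Module.finrank_zero_of_subsingleton

open Classical in
theorem hilbert_add_single (ℓ : Fin r → ℕ) (i : Fin r) :
    n.hilbert (ℓ + Pi.single i 1) = n.hilbert ℓ + if n.Jump ℓ i then 1 else 0 := by
  rw [← finrank_quotient_filtrationSubspace, ← finrank_quotient_filtrationSubspace]
  simp only [jump_iff_exists_leadCoeff_ne_zero]
  exact (finrank_quotient_inf_ker fun g => n.mem_filtration_add_single (i := i)).2

theorem sum_cast_add_single (ℓ : Fin r → ℕ) (i : Fin r) :
    ∑ j, ((ℓ + Pi.single i 1 : Fin r → ℕ) j : ℤ) = ∑ j, (ℓ j : ℤ) + 1 := by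
  simp only [Pi.add_apply, Nat.cast_add, Finset.sum_add_distrib]
  rw [← Nat.cast_sum Finset.univ (Pi.single i 1), Finset.sum_pi_single',
    if_pos (Finset.mem_univ i), Nat.cast_one]

open Classical in
theorem weight_add_single (ℓ : Fin r → ℕ) (i : Fin r) :
    n.weight (ℓ + Pi.single i 1) = n.weight ℓ + if n.Jump ℓ i then 1 else -1 := by
  rw [weight, weight, hilbert_add_single, sum_cast_add_single]
  split_ifs <;> push_cast <;> ring

theorem weight_lt_weight_add_single_iff {ℓ : Fin r → ℕ} {i : Fin r} :
    n.weight ℓ < n.weight (ℓ + Pi.single i 1) ↔ n.Jump ℓ i := by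
  rw [weight_add_single]
  split_ifs with h <;> simp [h]

theorem sub_single_add_single {p : Fin r → ℕ} {i : Fin r} (hi : 1 ≤ p i) :
    p - Pi.single i 1 + Pi.single i 1 = p :=
  tsub_add_cancel_of_le fun j => by
    rcases eq_or_ne j i with rfl | hj
    · simpa using hi
    · simp [hj]

/-- `p` is a generalized local minimum point when no jump leads to `p`. -/
theorem isGenLocalMin_iff {p : Fin r → ℕ} :
    n.IsGenLocalMin p ↔ ∀ i, 1 ≤ p i → ¬ n.Jump (p - Pi.single i 1) i := by
  refine forall_congr' fun i => forall_congr' fun hi => ?_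
  have h := n.weight_add_single (p - Pi.single i 1) i
  rw [sub_single_add_single hi] at h
  rw [h]
  split_ifs with hJ <;> simp [hJ]

theorem isLocalMin_iff {p : Fin r → ℕ} :
    n.IsLocalMin p ↔ (∀ i, n.Jump p i) ∧ n.IsGenLocalMin p :=
  and_congr (forall_congr' fun _ => n.weight_lt_weight_add_single_iff) Iff.rfl

/-- If the Hilbert function jumps at `ℓ` in every direction, a general element of `𝓕(ℓ)` has value
exactly `ℓ`: a vector space over `ℂ` is not a finite union of proper subspaces. -/
theorem exists_forall_val_eq {ℓ : Fin r → ℕ} (h : ∀ i, n.Jump ℓ i) :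
    ∃ g : C.LocalRing, ∀ i, n.val i g = ℓ i := by
  classical
  let φ : Fin r → n.filtrationSubspace ℓ →ₗ[ℂ] ℂ := fun i =>
    (n.leadCoeff ℓ i).comp (n.filtrationSubspace ℓ).subtype
  have htop : (⊤ : Subspace ℂ (n.filtrationSubspace ℓ)) ∉
      Finset.univ.image fun i => LinearMap.ker (φ i) := by
    rw [Finset.mem_image]
    rintro ⟨i, -, hi⟩
    obtain ⟨g, hg, hgi⟩ := n.jump_iff_exists_leadCoeff_ne_zero.mp (h i)
    have h0 : (⟨g, hg⟩ : n.filtrationSubspace ℓ) ∈ LinearMap.ker (φ i) := hi ▸ Submodule.mem_top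
    exact hgi h0
  have hne := Subspace.biUnion_ne_univ_of_top_notMem htop
  obtain ⟨⟨g, hg⟩, hgne⟩ := (Set.ne_univ_iff_exists_notMem _).mp hne
  refine ⟨g, fun i => (n.val_eq_iff hg i).mpr fun h0 => hgne ?_⟩
  simp only [Set.mem_iUnion]
  exact ⟨_, Finset.mem_image_of_mem _ (Finset.mem_univ i), h0⟩

variable {n} in
theorem mem_nonZeroDivisors_of_val_eq {ℓ : Fin r → ℕ} {g : C.LocalRing}
    (h : ∀ i, n.val i g = ℓ i) : g ∈ nonZeroDivisors C.LocalRing := by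
  suffices hcancel : ∀ a : C.LocalRing, a * g = 0 → a = 0 from
    mem_nonZeroDivisors_iff.mpr ⟨fun a ha => hcancel a ((mul_comm a g).trans ha), hcancel⟩
  intro a ha
  refine n.eq_zero_of_forall_branchHom_eq_zero fun i => ?_
  have h0 : n.branchHom i a * n.branchHom i g = 0 := by rw [← map_mul, ha, map_zero]
  refine (mul_eq_zero.mp h0).resolve_right fun hg => ?_
  have h1 := h i
  rw [val, hg, ord_zero] at h1
  exact absurd h1 (by simp)

theorem mem_semigroup_iff {p : Fin r → ℕ} : p ∈ n.semigroup ↔ ∀ i, n.Jump p i := by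
  constructor
  · rintro ⟨g, -, hg⟩ i
    exact ⟨g, fun j => (hg j).ge, hg i⟩
  · intro h
    obtain ⟨g, hg⟩ := n.exists_forall_val_eq h
    exact ⟨g, mem_nonZeroDivisors_of_val_eq hg, hg⟩

variable {n}

/-! ### Symmetry of the weight function below a minimum of weight zero -/

theorem weight_zero : n.weight 0 = 0 := by simp [weight, hilbert_zero]

/-- Jumps at complementary places would multiply to a jump that leads to `p`. -/
theorem IsGenLocalMin.not_jump_and_jump {p : Fin r → ℕ} (hp : n.IsGenLocalMin p) {ℓ ℓ' : Fin r → ℕ}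
    {i : Fin r} (h : ℓ + ℓ' + Pi.single i 1 = p) : ¬ (n.Jump ℓ i ∧ n.Jump ℓ' i) := by
  rintro ⟨h1, h2⟩
  refine n.isGenLocalMin_iff.mp hp i (by simp [← h]) ?_
  rw [← h, add_tsub_cancel_right]
  exact h1.add h2

theorem IsGenLocalMin.weight_reflect_mono {p : Fin r → ℕ} (hp : n.IsGenLocalMin p)
    {ℓ ℓ' : Fin r → ℕ} (h : ℓ ≤ ℓ') (h' : ℓ' ≤ p) :
    n.weight (p - ℓ) - n.weight ℓ ≤ n.weight (p - ℓ') - n.weight ℓ' := by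
  refine lattice_induction
    (P := fun ℓ' => n.weight (p - ℓ) - n.weight ℓ ≤ n.weight (p - ℓ') - n.weight ℓ')
    h le_rfl fun q i _ hq ih => ih.trans ?_
  replace hq := hq.trans h'
  have h1 : p - q = p - (q + Pi.single i 1) + Pi.single i 1 := by
    rw [← tsub_tsub, tsub_add_cancel_of_le (le_tsub_of_add_le_left hq)]
  have h2 : q + (p - (q + Pi.single i 1)) + Pi.single i 1 = p := by
    rw [add_right_comm, add_tsub_cancel_of_le hq]
  have h3 := hp.not_jump_and_jump h2
  rw [h1, weight_add_single, weight_add_single]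
  split_ifs with ha hb hb
  · exact absurd ⟨hb, ha⟩ h3
  all_goals linarith

theorem IsGenLocalMin.weight_nonpos {p : Fin r → ℕ} (hp : n.IsGenLocalMin p) : n.weight p ≤ 0 := by
  have h := hp.weight_reflect_mono (zero_le (a := p)) le_rfl
  rw [tsub_zero, tsub_self, weight_zero] at h
  linarith

theorem IsGenLocalMin.weight_sub_eq {p : Fin r → ℕ} (hp : n.IsGenLocalMin p) (hw : n.weight p = 0)
    {ℓ : Fin r → ℕ} (hℓ : ℓ ≤ p) : n.weight (p - ℓ) = n.weight ℓ := by
  have h1 := hp.weight_reflect_mono (zero_le (a := ℓ)) hℓ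
  have h2 := hp.weight_reflect_mono hℓ le_rfl
  rw [tsub_zero, weight_zero, hw] at h1
  rw [tsub_self, weight_zero, hw] at h2
  linarith

/-! ### Multiplication by a general element of the maximal ideal -/

theorem single_le_minVal (n : C.Normalization r) (i : Fin r) :
    (Pi.single i 1 : Fin r → ℕ) ≤ n.minVal := fun j => by
  rcases eq_or_ne j i with rfl | hj
  · simpa using n.one_le_minVal j
  · simp [hj]

theorem jump_minVal (n : C.Normalization r) (i : Fin r) : n.Jump n.minVal i := by
  obtain ⟨g, hg, hgi⟩ := n.exists_val_eq_minVal i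
  exact ⟨g, n.minVal_le_val hg, hgi⟩

theorem filtration_eq_localMaxIdeal {ℓ : Fin r → ℕ} (h0 : ℓ ≠ 0) (h : ℓ ≤ n.minVal) :
    n.filtration ℓ = C.localMaxIdeal := by
  obtain ⟨i, hi⟩ := Function.ne_iff.mp h0
  refine le_antisymm (fun g hg => (n.mem_localMaxIdeal_iff i g).mpr ?_) fun g hg j =>
    (Nat.cast_le.mpr (h j)).trans (n.minVal_le_val hg j)
  exact le_trans (by exact_mod_cast Nat.one_le_iff_ne_zero.mpr hi) (hg i)

theorem hilbert_eq_one {ℓ : Fin r → ℕ} (h0 : ℓ ≠ 0) (h : ℓ ≤ n.minVal) : n.hilbert ℓ = 1 := by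
  obtain ⟨i⟩ := n.nonempty_index
  have h1 := n.hilbert_add_single 0 i
  rw [if_pos (n.jump_zero i), hilbert_zero, zero_add, zero_add, hilbert,
    filtration_eq_localMaxIdeal (by simp) (n.single_le_minVal i)] at h1
  rwa [hilbert, filtration_eq_localMaxIdeal h0 h]

theorem minVal_ne_zero : n.minVal ≠ 0 := by
  obtain ⟨i⟩ := n.nonempty_index
  exact fun h => by simpa [h] using n.one_le_minVal i

theorem weight_minVal : n.weight n.minVal = 2 - ∑ i, (n.minVal i : ℤ) := by
  rw [weight, hilbert_eq_one minVal_ne_zero le_rfl]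
  norm_num

/-- A point of the semigroup other than `0` comes from the maximal ideal. -/
theorem minVal_le_of_jump {p : Fin r → ℕ} (h0 : p ≠ 0) (h : ∀ i, n.Jump p i) : n.minVal ≤ p := by
  obtain ⟨g, hg⟩ := n.exists_forall_val_eq h
  obtain ⟨i, hi⟩ := Function.ne_iff.mp h0
  have hgm : g ∈ C.localMaxIdeal := by
    rw [n.mem_localMaxIdeal_iff i, hg]
    exact_mod_cast Nat.one_le_iff_ne_zero.mpr hi
  intro j
  have := n.minVal_le_val hgm j
  rw [hg] at this
  exact_mod_cast this

/-- On a smooth curve germ there is no generalized local minimum point other than `0`. -/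
theorem IsGenLocalMin.minVal_ne_single {p : Fin r → ℕ} (hp : n.IsGenLocalMin p)
    (hm : n.minVal ≤ p) (i : Fin r) : n.minVal ≠ Pi.single i 1 := by
  intro h
  have hall : ∀ j, j = i := fun j => by
    by_contra hj
    have h1 := n.one_le_minVal j
    simp [h, hj] at h1
  have hpow : ∀ k : ℕ, n.Jump (k • n.minVal) i := fun k => by
    induction k with
    | zero => simpa using n.jump_zero i
    | succ k ih =>
      rw [succ_nsmul]
      exact ih.add (n.jump_minVal i)
  refine n.isGenLocalMin_iff.mp hp i ((n.one_le_minVal i).trans (hm i)) ?_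
  convert hpow (p i - 1) using 1
  funext j
  rw [hall j, h]
  simp

/-- A generalized local minimum point of weight zero above `𝐦` is a point of the semigroup. -/
theorem IsGenLocalMin.jump_of_weight_eq_zero {p : Fin r → ℕ} (hp : n.IsGenLocalMin p)
    (hw : n.weight p = 0) (hm : n.minVal ≤ p) (i : Fin r) : n.Jump p i := by
  have hadd := sub_single_add_single (n.one_le_minVal i)
  set ℓ := n.minVal - Pi.single i 1 with hℓ
  have hℓm : ℓ ≤ n.minVal := tsub_le_self
  have hℓ0 : ℓ ≠ 0 := fun h => hp.minVal_ne_single hm i (by rw [← hadd, h, zero_add])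
  -- By reflection, the missing jump from `𝐦 - e_i` to `𝐦` gives a jump from `p - 𝐦`.
  have hlt : n.weight n.minVal < n.weight ℓ := by
    rw [weight, weight, hilbert_eq_one hℓ0 hℓm, hilbert_eq_one minVal_ne_zero le_rfl,
      ← hadd,
      sum_cast_add_single]
    linarith
  rw [← hp.weight_sub_eq hw hm, ← hp.weight_sub_eq hw (hℓm.trans hm)] at hlt
  have h1 : p - ℓ = p - n.minVal + Pi.single i 1 := by
    conv_rhs => rw [← hadd, ← tsub_tsub]
    refine (tsub_add_cancel_of_le (le_tsub_of_add_le_left ?_)).symm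
    rwa [hadd]
  rw [h1, weight_lt_weight_add_single_iff] at hlt
  have h2 := hlt.add (n.jump_minVal i)
  rwa [tsub_add_cancel_of_le hm] at h2

/-- The weight grows at most as fast as the degree. -/
theorem weight_sub_weight_le {ℓ ℓ' : Fin r → ℕ} (h : ℓ ≤ ℓ') :
    n.weight ℓ' - n.weight ℓ ≤ ∑ i, (ℓ' i : ℤ) - ∑ i, (ℓ i : ℤ) := by
  refine lattice_induction
    (P := fun ℓ' => n.weight ℓ' - n.weight ℓ ≤ ∑ i, (ℓ' i : ℤ) - ∑ i, (ℓ i : ℤ))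
    h (by simp) fun q i _ _ ih => ?_
  rw [sum_cast_add_single, weight_add_single]
  split_ifs <;> linarith

theorem weight_translate_mono {ℓ ℓ' : Fin r → ℕ} (h : ℓ ≤ ℓ') :
    n.weight (ℓ + n.minVal) - n.weight ℓ ≤ n.weight (ℓ' + n.minVal) - n.weight ℓ' := by
  refine lattice_induction
    (P := fun ℓ' => n.weight (ℓ + n.minVal) - n.weight ℓ ≤ n.weight (ℓ' + n.minVal) - n.weight ℓ')
    h le_rfl fun q i _ _ ih => ih.trans ?_
  rw [add_right_comm, weight_add_single, weight_add_single]
  have hJ : n.Jump q i → n.Jump (q + n.minVal) i := fun h => h.add (n.jump_minVal i)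
  split_ifs with ha hb hb
  · linarith
  · linarith
  · exact absurd (hJ hb) ha
  · linarith

/-- If the weight gains `|𝐦|` from `ℓ` to `ℓ + 𝐦`, every step in between is a jump. -/
theorem jump_of_weight_translate {ℓ : Fin r → ℕ}
    (h : ∑ i, (n.minVal i : ℤ) ≤ n.weight (ℓ + n.minVal) - n.weight ℓ) (i : Fin r) :
    n.Jump ℓ i := by
  by_contra hJ
  have hle : ℓ + Pi.single i 1 ≤ ℓ + n.minVal := add_le_add le_rfl (n.single_le_minVal i)
  have h1 := weight_sub_weight_le (n := n) hle
  rw [weight_add_single, if_neg hJ, sum_cast_add_single] at h1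
  simp only [Pi.add_apply, Nat.cast_add, Finset.sum_add_distrib] at h1
  linarith

/-- If the weight gained only `|𝐦| - 2` from `p` to `p + 𝐦`, then `p + 𝐦` would be a generalized
local minimum point of positive weight. -/
theorem IsGenLocalMin.lt_weight_translate {p : Fin r → ℕ} (hp : n.IsGenLocalMin p)
    (hw : n.weight p = 0) (hm : n.minVal ≤ p) (h3 : 3 ≤ ∑ i, (n.minVal i : ℤ)) :
    ∑ i, (n.minVal i : ℤ) - 2 < n.weight (p + n.minVal) - n.weight p := by
  by_contra! hle
  have hlow : n.weight (p - n.minVal + n.minVal) - n.weight (p - n.minVal) =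
      ∑ i, (n.minVal i : ℤ) - 2 := by
    rw [tsub_add_cancel_of_le hm, hw, hp.weight_sub_eq hw hm, weight_minVal]
    ring
  have hgen : n.IsGenLocalMin (p + n.minVal) := fun i _ => by
    have hpi := (n.one_le_minVal i).trans (hm i)
    have hsub : p - n.minVal ≤ p - Pi.single i 1 := tsub_le_tsub_left (n.single_le_minVal i) p
    have h1 := weight_translate_mono (n := n) hsub
    have h2 := weight_translate_mono (n := n) (tsub_le_self (a := p) (b := Pi.single i 1))
    have h4 := hp i hpi
    have h5 : p + n.minVal - Pi.single i 1 = p - Pi.single i 1 + n.minVal := by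
      conv_lhs => rw [← sub_single_add_single hpi, add_right_comm, add_tsub_cancel_right]
    rw [h5]
    linarith
  have h1 := hgen.weight_nonpos
  have h2 := weight_translate_mono (n := n) (tsub_le_self (a := p) (b := n.minVal))
  linarith

/-- Beyond a nonzero local minimum point of weight zero the Hilbert function always jumps. -/
theorem IsLocalMin.jump_of_le {p : Fin r → ℕ} (hp : n.IsLocalMin p) (hw : n.weight p = 0)
    (h0 : p ≠ 0) (h3 : 3 ≤ ∑ i, (n.minVal i : ℤ)) {ℓ : Fin r → ℕ} (hℓ : p ≤ ℓ) (i : Fin r) :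
    n.Jump ℓ i := by
  obtain ⟨hJ, hgen⟩ := n.isLocalMin_iff.mp hp
  have hm := minVal_le_of_jump h0 hJ
  have h1 := hgen.lt_weight_translate hw hm h3
  -- The gain has the parity of `|𝐦|`, so it is at least `|𝐦|` once it exceeds `|𝐦| - 2`.
  have h2 : ∑ i, (n.minVal i : ℤ) ≤ n.weight (p + n.minVal) - n.weight p := by
    simp only [weight, Pi.add_apply, Nat.cast_add, Finset.sum_add_distrib] at h1 ⊢
    omega
  exact jump_of_weight_translate (h2.trans (weight_translate_mono hℓ)) i

/-! ### The conductor -/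

/-- If the Hilbert function always jumps beyond `p`, successive approximation shows that the local
algebra contains `t ^ p` times the normalization. -/
theorem containsFrom_of_forall_jump {p : Fin r → ℕ} (h : ∀ ℓ, p ≤ ℓ → ∀ i, n.Jump ℓ i) :
    n.ContainsFrom p := by
  obtain ⟨K, hK⟩ := n.exists_containsFrom
  refine lattice_induction (a := p) (b := p ⊔ K) (P := fun ℓ => n.ContainsFrom ℓ → n.ContainsFrom p)
    le_sup_left id (fun ℓ i hℓ _ ih hup => ih fun y hy => ?_)
    fun y hy => hK y fun i => (Nat.cast_le.mpr le_sup_right).trans (hy i)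
  obtain ⟨g, hg, hgi⟩ := h ℓ hℓ i
  have hc := (n.val_eq_iff hg i).mp hgi
  set c := taylorCoeff (ℓ i) (y i) / n.leadCoeff ℓ i g with hcdef
  have hmem : y - n.normHom (c • g) ∈ n.normHom.range := by
    refine hup _ fun j => ?_
    have hcg : c • g ∈ n.filtration ℓ := (n.filtrationSubspace ℓ).smul_mem c hg
    have hj : (ℓ j : ℕ∞) ≤ ord ((y - n.normHom (c • g)) j) := le_ord_sub (hy j) (hcg j)
    rcases eq_or_ne j i with rfl | hji
    · rw [Pi.add_apply, Pi.single_eq_same, succ_le_ord_iff hj]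
      change taylorCoeff (ℓ j) (y j - n.branchHom j (c • g)) = 0
      rw [map_sub]
      change _ - n.leadCoeff ℓ j (c • g) = 0
      rw [map_smul, smul_eq_mul, hcdef, div_mul_cancel₀ _ hc, sub_self]
    · rwa [Pi.add_apply, Pi.single_eq_of_ne hji, add_zero]
  have h1 : n.normHom (c • g) ∈ n.normHom.range := ⟨c • g, rfl⟩
  have h2 := n.normHom.range.add_mem hmem h1
  rwa [sub_add_cancel] at h2

/-- A point that no jump leads to, and beyond which every step is a jump, is the conductor. -/
theorem IsGenLocalMin.eq_conductor {p : Fin r → ℕ} (hp : n.IsGenLocalMin p)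
    (h : ∀ ℓ, p ≤ ℓ → ∀ i, n.Jump ℓ i) : p = n.conductor := by
  funext i
  have hmem : ∃ g ∈ n.conductorIdeal, n.val i g = p i := by
    obtain ⟨g, hg⟩ := n.exists_forall_val_eq (h p le_rfl)
    exact ⟨g, fun x => containsFrom_of_forall_jump h _ fun j => by
      change _ ≤ ord (n.branchHom j g * x j)
      rw [ord_mul]
      exact (hg j).ge.trans le_self_add, hg i⟩
  refine le_antisymm (le_csInf ⟨p i, hmem⟩ ?_) (Nat.sInf_le hmem)
  rintro k ⟨g, hg, hgk⟩
  by_contra! hk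
  -- A suitable multiple of `g` in the normalization would be a jump that leads to `p`.
  let x : Fin r → HolGerm ℂ := fun j => if j = i then coord ^ (p i - 1 - k) else coord ^ p j
  obtain ⟨g', hg'⟩ := hg x
  have hval : ∀ j, n.val j g' = n.val j g + ord (x j) := fun j => by
    rw [val, val, ← ord_mul]
    exact congrArg ord (congrFun hg' j)
  have hvi : n.val i g' = ((p - Pi.single i 1 : Fin r → ℕ) i : ℕ∞) := by
    rw [hval, hgk]
    simp only [x, if_true, ord_coord_pow, Pi.sub_apply, Pi.single_eq_same]
    rw [← Nat.cast_add]
    congr 1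
    omega
  refine n.isGenLocalMin_iff.mp hp i (by omega) ⟨g', fun j => ?_, hvi⟩
  rcases eq_or_ne j i with rfl | hj
  · exact hvi.ge
  · rw [hval]
    simp only [x, if_neg hj, ord_coord_pow, Pi.sub_apply, Pi.single_eq_of_ne hj, tsub_zero]
    exact le_add_self

/-! ### The multiplicity -/

theorem ContainsFrom.mono {K ℓ : Fin r → ℕ} (hK : n.ContainsFrom K) (h : K ≤ ℓ) :
    n.ContainsFrom ℓ := fun y hy => hK y fun i => (Nat.cast_le.mpr (h i)).trans (hy i)

theorem ContainsFrom.jump {K : Fin r → ℕ} (hK : n.ContainsFrom K) (i : Fin r) : n.Jump K i := by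
  obtain ⟨g, hg⟩ := hK (fun j => coord ^ K j) fun j => (ord_coord_pow _).ge
  have hval : ∀ j, n.val j g = K j := fun j => by
    rw [← ord_coord_pow]
    exact congrArg ord (congrFun hg j)
  exact ⟨g, fun j => (hval j).ge, hval i⟩

/-- Beyond the conductor the Hilbert function is affine. -/
theorem ContainsFrom.hilbert_eq {K ℓ : Fin r → ℕ} (hK : n.ContainsFrom K) (h : K ≤ ℓ) :
    (n.hilbert ℓ : ℤ) = n.hilbert K + (∑ i, (ℓ i : ℤ) - ∑ i, (K i : ℤ)) := by
  refine lattice_induction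
    (P := fun ℓ => (n.hilbert ℓ : ℤ) = n.hilbert K + (∑ i, (ℓ i : ℤ) - ∑ i, (K i : ℤ)))
    h (by simp) fun ℓ i hℓ _ ih => ?_
  rw [hilbert_add_single, if_pos ((hK.mono hℓ).jump i), sum_cast_add_single]
  push_cast
  linarith

/-- Beyond the conductor, divisibility in the local algebra is decided by the values. -/
theorem ContainsFrom.exists_eq_mul {K s : Fin r → ℕ} (hK : n.ContainsFrom K) {z g : C.LocalRing}
    (hz : ∀ i, n.val i z = s i) (hg : g ∈ n.filtration (s + K)) :
    ∃ q ∈ n.filtration K, g = z * q := by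
  have hle : ∀ i, ord (n.branchHom i z) ≤ ord (n.branchHom i g) := fun i =>
    (hz i).le.trans ((Nat.cast_le.mpr le_self_add).trans (hg i))
  choose q hq using fun i => dvd_of_ord_le (hle i)
  have hord : ∀ i, (K i : ℕ∞) ≤ ord (q i) := fun i => by
    have h := hg i
    rw [val, hq i, ord_mul, Pi.add_apply, Nat.cast_add, ← val, hz i] at h
    exact (ENat.add_le_add_iff_left (ENat.natCast_ne_top _)).mp h
  obtain ⟨q', hq'⟩ := hK q hord
  have hq'' : ∀ i, n.branchHom i q' = q i := fun i => congrFun hq' i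
  refine ⟨q', fun i => (hord i).trans_eq (congrArg ord (hq'' i).symm),
    n.normHom_injective (funext fun i => ?_)⟩
  change n.branchHom i g = n.branchHom i (z * q')
  rw [map_mul, hq'', hq i]

theorem localMaxIdeal_pow_le (k : ℕ) : C.localMaxIdeal ^ k ≤ n.filtration (k • n.minVal) := by
  induction k with
  | zero => simp [filtration_zero]
  | succ k ih =>
    rw [pow_succ, succ_nsmul, Ideal.mul_le]
    refine fun g hg g' hg' => n.mul_mem_filtration (ih hg) ?_
    rwa [filtration_eq_localMaxIdeal minVal_ne_zero le_rfl]

/-- The powers of the maximal ideal as complex subspaces. -/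
abbrev maxPow (C : CurveGerm N) (k : ℕ) : Submodule ℂ C.LocalRing :=
  (C.localMaxIdeal ^ k).restrictScalars ℂ

theorem val_pow_eq {x : C.LocalRing} (hx : ∀ i, n.val i x = n.minVal i) (k : ℕ) (i : Fin r) :
    n.val i (x ^ k) = ((k • n.minVal) i : ℕ) := by
  rw [val, map_pow, ord_pow, ← val, hx, Pi.smul_apply, smul_eq_mul, Nat.cast_mul]

theorem mem_localMaxIdeal_of_val_eq {x : C.LocalRing} (hx : ∀ i, n.val i x = n.minVal i) :
    x ∈ C.localMaxIdeal := by
  rw [← filtration_eq_localMaxIdeal (n := n) minVal_ne_zero le_rfl]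
  exact fun i => (hx i).ge

theorem finite_quotient_maxPow (n : C.Normalization r) (k : ℕ) :
    Module.Finite ℂ (C.LocalRing ⧸ maxPow C k) := by
  obtain ⟨x, hx⟩ := n.exists_forall_val_eq n.jump_minVal
  obtain ⟨K, hK⟩ := n.exists_containsFrom
  have hle : n.filtrationSubspace (k • n.minVal + K) ≤ maxPow C k := fun g hg => by
    obtain ⟨q, -, rfl⟩ := hK.exists_eq_mul (val_pow_eq hx k) hg
    exact Ideal.mul_mem_right _ _ (Ideal.pow_mem_pow (mem_localMaxIdeal_of_val_eq hx) k)
  exact Module.Finite.of_surjective (Submodule.factor hle) (Submodule.factor_surjective hle)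

/-- The image of `𝓕(k𝐦)` in `𝓞 / 𝔪 ^ k`; its dimension is the difference between
`dim 𝓞 / 𝔪 ^ k` and `𝔥(k𝐦)`. -/
def excess (n : C.Normalization r) (k : ℕ) : Submodule ℂ (C.LocalRing ⧸ maxPow C k) :=
  (n.filtrationSubspace (k • n.minVal)).map (maxPow C k).mkQ

theorem finrank_quotient_maxPow (n : C.Normalization r) (k : ℕ) :
    Module.finrank ℂ (C.LocalRing ⧸ maxPow C k) =
      n.hilbert (k • n.minVal) + Module.finrank ℂ (n.excess k) := by
  have := n.finite_quotient_maxPow k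
  have hle : maxPow C k ≤ n.filtrationSubspace (k • n.minVal) := localMaxIdeal_pow_le k
  rw [← Submodule.finrank_quotient_add_finrank (n.excess k),
    ← finrank_quotient_filtrationSubspace]
  congr 1
  exact (Submodule.quotientQuotientEquivQuotient _ _ hle).finrank_eq

/-- Beyond the conductor, multiplication by a general element `x` of the maximal ideal maps
`𝓕(k𝐦)` onto `𝓕((k + 1)𝐦)`. -/
theorem finrank_excess_succ_le {k : ℕ} (hk : n.ContainsFrom (k • n.minVal)) :
    Module.finrank ℂ (n.excess (k + 1)) ≤ Module.finrank ℂ (n.excess k) := by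
  have := n.finite_quotient_maxPow k
  have := n.finite_quotient_maxPow (k + 1)
  obtain ⟨x, hx⟩ := n.exists_forall_val_eq n.jump_minVal
  have hxm := mem_localMaxIdeal_of_val_eq hx
  let μ : (C.LocalRing ⧸ maxPow C k) →ₗ[ℂ] C.LocalRing ⧸ maxPow C (k + 1) :=
    Submodule.mapQ _ _ (LinearMap.mulLeft ℂ x) fun g hg => by
      change x * g ∈ C.localMaxIdeal ^ (k + 1)
      rw [pow_succ']
      exact Ideal.mul_mem_mul hxm hg
  have hle : n.excess (k + 1) ≤ (n.excess k).map μ := by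
    rintro _ ⟨g, hg, rfl⟩
    have hg' : g ∈ n.filtration (n.minVal + k • n.minVal) := by
      rw [← succ_nsmul']
      exact hg
    obtain ⟨q, hq, rfl⟩ := hk.exists_eq_mul hx hg'
    exact ⟨(maxPow C k).mkQ q, ⟨q, hq, rfl⟩, rfl⟩
  exact (Submodule.finrank_mono hle).trans (Submodule.finrank_map_le μ _)

/-- The multiplicity of a curve is the sum of the smallest values on the maximal ideal. -/
theorem multiplicity_eq (n : C.Normalization r) : multiplicity C.ideal = ∑ i, n.minVal i := by
  obtain ⟨K, hK⟩ := n.exists_containsFrom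
  have hfar : ∀ k, ∑ i, K i ≤ k → n.ContainsFrom (k • n.minVal) := fun k hk =>
    hK.mono fun i => by
      have h1 : K i ≤ k := (Finset.single_le_sum (fun _ _ => Nat.zero_le _)
        (Finset.mem_univ i)).trans hk
      exact h1.trans (Nat.le_mul_of_pos_right k (n.one_le_minVal i))
  -- The nonincreasing sequence of dimensions becomes constant where it attains its minimum.
  let q : ℕ → ℕ := fun k => Module.finrank ℂ (n.excess (∑ i, K i + k))
  have hq : Antitone q := antitone_nat_of_succ_le fun k =>
    finrank_excess_succ_le (hfar _ le_self_add)
  obtain ⟨_, ⟨k₁, rfl⟩, hmin⟩ := wellFounded_lt.has_min (Set.range q) (Set.range_nonempty q)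
  have hconst : ∀ k, k₁ ≤ k → q k = q k₁ := fun k hk =>
    le_antisymm (hq hk) (not_lt.mp (hmin _ ⟨k, rfl⟩))
  obtain ⟨b, hb⟩ : ∃ b : ℤ, ∀ᶠ k : ℕ in atTop,
      (Module.finrank ℂ (C.LocalRing ⧸ C.localMaxIdeal ^ k) : ℤ) =
        (∑ i, n.minVal i : ℕ) * k + b := by
    refine ⟨n.hilbert K - ∑ i, (K i : ℤ) + q k₁, ?_⟩
    filter_upwards [eventually_ge_atTop (∑ i, K i + k₁)] with k hk
    obtain ⟨j, rfl⟩ := Nat.exists_eq_add_of_le ((Nat.le_add_right _ k₁).trans hk)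
    have hle : K ≤ (∑ i, K i + j) • n.minVal := fun i => by
      have h1 : K i ≤ ∑ i, K i + j := (Finset.single_le_sum (fun _ _ => Nat.zero_le _)
        (Finset.mem_univ i)).trans le_self_add
      exact h1.trans (Nat.le_mul_of_pos_right _ (n.one_le_minVal i))
    have h1 := n.finrank_quotient_maxPow (∑ i, K i + j)
    have h2 := hK.hilbert_eq hle
    have h3 : Module.finrank ℂ (n.excess (∑ i, K i + j)) = q k₁ := hconst j (by omega)
    rw [h3, (Submodule.Quotient.restrictScalarsEquiv ℂ _).finrank_eq] at h1
    have h4 : ∑ i, (((∑ i, K i + j) • n.minVal : Fin r → ℕ) i : ℤ) =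
        (∑ i, n.minVal i : ℕ) * (∑ i, K i + j : ℕ) := by
      rw [← Nat.cast_sum, ← Nat.cast_mul, Finset.sum_mul]
      congr 1
      exact Finset.sum_congr rfl fun i _ => mul_comm _ _
    rw [h1, Nat.cast_add, h2, h4]
    ring
  have hset : {a : ℕ | ∃ b : ℤ, ∀ᶠ k : ℕ in atTop,
      (Module.finrank ℂ (C.LocalRing ⧸ C.localMaxIdeal ^ k) : ℤ) = a * k + b} =
        {∑ i, n.minVal i} := by
    ext a
    refine ⟨?_, fun h => ⟨b, by rwa [Set.mem_singleton_iff.mp h]⟩⟩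
    rintro ⟨b', hb'⟩
    obtain ⟨k, hk⟩ := eventually_atTop.mp (hb.and hb')
    obtain ⟨h1, h2⟩ := hk k le_rfl
    obtain ⟨h3, h4⟩ := hk (k + 1) (Nat.le_succ k)
    push_cast at h1 h2 h3 h4
    have h5 : (a : ℤ) = ∑ i, (n.minVal i : ℤ) := by linarith
    exact_mod_cast h5
  exact (congrArg sInf hset).trans (csInf_singleton _)

/-- The branch `C_i` as a curve in its own right. -/
def branch (n : C.Normalization r) (i : Fin r) : CurveGerm N where
  ideal := n.branchIdeal i
  ne_top := by
    have h : n.branchIdeal i ∈ C.ideal.minimalPrimes := n.range_ker ▸ ⟨i, rfl⟩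
    exact h.1.1.ne_top
  isRadical := by
    have h : n.branchIdeal i ∈ C.ideal.minimalPrimes := n.range_ker ▸ ⟨i, rfl⟩
    exact h.1.1.isRadical
  dim_one P hP := by
    have h : n.branchIdeal i ∈ C.ideal.minimalPrimes := n.range_ker ▸ ⟨i, rfl⟩
    have := h.1.1
    rw [Ideal.minimalPrimes_eq_subsingleton_self, Set.mem_singleton_iff] at hP
    rw [hP]
    exact C.dim_one _ h

/-- The normalization of the branch `C_i`. -/
def branchNormalization (n : C.Normalization r) (i : Fin r) : (n.branch i).Normalization 1 where
  param _ := n.param i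
  analyticAt _ := n.analyticAt i
  param_zero _ := n.param_zero i
  ker_injective := Function.injective_of_subsingleton _
  range_ker := by
    have h : n.branchIdeal i ∈ C.ideal.minimalPrimes := n.range_ker ▸ ⟨i, rfl⟩
    have : (n.branch i).ideal.IsPrime := h.1.1
    rw [Ideal.minimalPrimes_eq_subsingleton_self, Set.range_const]
    rfl
  integral _ := n.integral i
  birational _ := n.birational i

theorem minVal_eq_sInf (n : C.Normalization r) (i : Fin r) : n.minVal i =
    sInf {k : ℕ | ∃ g ∈ maxIdeal (Fin N → ℂ),
      ord (pullback (n.param i) (n.analyticAt i) (n.param_zero i) g) = k} := by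
  refine congrArg sInf (Set.ext fun k => ⟨?_, ?_⟩)
  · rintro ⟨g, hg, hk⟩
    obtain ⟨g, hg', rfl⟩ :=
      (Ideal.mem_map_iff_of_surjective _ Ideal.Quotient.mk_surjective).mp hg
    exact ⟨g, hg', hk⟩
  · rintro ⟨g, hg, hk⟩
    exact ⟨_, Ideal.mem_map_of_mem _ hg, hk⟩

theorem multVec_eq (n : C.Normalization r) : n.multVec = n.minVal := by
  funext i
  have h := (n.branchNormalization i).multiplicity_eq
  rw [Finset.univ_unique, Finset.sum_singleton, minVal_eq_sInf] at h
  rw [minVal_eq_sInf]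
  exact h

end Normalization

end CurveGerm

end CurveSing

end

theorem mainTheorem6 {N : ℕ} (C : CurveSing.CurveGerm N) {r : ℕ} (n : C.Normalization r) :
    (∀ p : Fin r → ℕ, n.IsGenLocalMin p → n.weight p = 0 →
      (∀ ℓ : Fin r → ℕ, ℓ ≤ p → n.weight (p - ℓ) = n.weight ℓ) ∧
      (n.multVec ≤ p → n.IsLocalMin p ∧ p ∈ n.semigroup)) ∧
    (3 ≤ CurveSing.multiplicity C.ideal →
      ∀ p : Fin r → ℕ, n.IsLocalMin p → n.weight p = 0 → p = 0 ∨ p = n.conductor) := by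
  rw [n.multVec_eq, n.multiplicity_eq]
  refine ⟨fun p hp hw => ⟨fun ℓ hℓ => hp.weight_sub_eq hw hℓ, fun hm => ?_⟩,
    fun h3 p hp hw => or_iff_not_imp_left.mpr fun h0 => ?_⟩
  · have hJ := hp.jump_of_weight_eq_zero hw hm
    exact ⟨n.isLocalMin_iff.mpr ⟨hJ, hp⟩, n.mem_semigroup_iff.mpr hJ⟩
  · exact (n.isLocalMin_iff.mp hp).2.eq_conductor fun ℓ hℓ =>
      hp.jump_of_le hw h0 (by exact_mod_cast h3) hℓ
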